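/- We use the model of quantum communication without prior entanglement. Alice receives $x\in\{0,1\}^n$ and Bob receives $y\in\{0,1\}^n$. Both players have a finite private set of qubits; at the start $n$ of Alice's qubits are initialized to $x$, $n$ of Bob's qubits are initialized to $y$, and all other qubits are in the state $|0\rangle$. In each communication round one of the players applies a unitary transformation to the qubits in his possession and then sends one of his qubits to the other player. The acting players, the unitary transformations and the qubits to be sent are fixed in advance, independently of the inputs. At the end some fixed qubit is measured in the computational basis and the result is the output. The communication of the protocol is the number of qubits exchanged. For $f:\{0,1\}^n\times\{0,1\}^n\to\{0,1\}$ let $BQC(f)$ be the least communication of a protocol that on every input $(x,y)$ outputs $f(x,y)$ with probability at least $2/3$. For an integer $t$ let $HAM_n^t:\{0,1\}^n\times\{0,1\}^n\to\{0,1\}$ be given by $$HAM_n^t(x,y)=1\iff |\{i : x_i\neq y_i\}|\neq t .$$ **Theorem.** $BQC(HAM_n^{n/2})=\Omega(n/\log n)$ for even $n$; that is, there are a constant $C>0$ and an $N$ such that for all even $n\ge N$ $$BQC\bigl(HAM_n^{n/2}\bigr)\ \ge\ C\,\frac{n}{\log_2 n}.$$ -/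

import Mathlib

open scoped ENNReal

namespace QuantumCommunication

/-- The two players of a communication protocol. -/
inductive Player where
  | alice : Player
  | bob : Player

instance : DecidableEq Player
  | .alice, .alice => isTrue rfl
  | .bob, .bob => isTrue rfl
  | .alice, .bob => isFalse (fun h => nomatch h)
  | .bob, .alice => isFalse (fun h => nomatch h)

/-- The partner of a player. -/
def Player.other : Player → Player
  | .alice => .bob
  | .bob => .alice

/-- A vector of the Hilbert space `(ℂ²)^{⊗ m}` of `m` qubits, given by its amplitudes in the
computational basis, which is indexed by the bit strings `Fin m → Bool`. -/
abbrev State (m : ℕ) : Type := (Fin m → Bool) → ℂ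

/-- The assignments of bits to the qubits that player `p` possesses, when `own` tells who
possesses which qubit: the computational basis of the space of the qubits of `p`. -/
abbrev LocalBasis {m : ℕ} (own : Fin m → Player) (p : Player) : Type :=
  {i : Fin m // own i = p} → Bool

/-- The bit string that agrees with `s` on the qubits of `p` and with `b` on the other qubits. -/
def overwrite {m : ℕ} (own : Fin m → Player) (p : Player) (s : LocalBasis own p)
    (b : Fin m → Bool) : Fin m → Bool :=
  fun i => if h : own i = p then s ⟨i, h⟩ else b i

/-- The action on a global state of an operator `U` on the qubits of player `p`, that is, of the
operator `U ⊗ id`, where `id` acts on the qubits of the other player. -/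
noncomputable def applyLocal {m : ℕ} (own : Fin m → Player) (p : Player)
    (U : Matrix (LocalBasis own p) (LocalBasis own p) ℂ) (ψ : State m) : State m :=
  fun b => ∑ s : LocalBasis own p, U (fun i => b i) s * ψ (overwrite own p s b)

/-- The instructions for `c` communication rounds on `m` qubits, followed by a measurement, when
the qubits are initially distributed between the players according to `own`. In a round, a player
`p` applies a unitary transformation `U` to the qubits in his possession and then sends one of his
qubits `q` to the other player: the latter changes the possession of `q` but not the global state.
All these choices are fixed in advance, independently of the inputs. At the end some qubit `out`
is measured. -/
inductive Rounds {m : ℕ} : (Fin m → Player) → ℕ → Type where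
  | measure {own : Fin m → Player} (out : Fin m) : Rounds own 0
  | round {own : Fin m → Player} {c : ℕ} (p : Player)
      (U : Matrix.unitaryGroup (LocalBasis own p) ℂ) (q : Fin m) (hq : own q = p)
      (rest : Rounds (Function.update own q p.other) c) : Rounds own (c + 1)

/-- The probability that the final measurement yields the bit `v`, when the rounds are executed
starting from the global state `ψ`. -/
noncomputable def Rounds.outputProb {m : ℕ} {own : Fin m → Player} {c : ℕ} :
    Rounds own c → State m → Bool → ℝ
  | .measure out, ψ, v => ∑ b : Fin m → Bool, if b out = v then ‖ψ b‖ ^ 2 else 0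
  | .round p U _ _ rest, ψ, v => rest.outputProb (applyLocal own p U.1 ψ) v

/-- A quantum communication protocol (without prior entanglement) for inputs
`x, y ∈ {0,1}^n`, in which exactly `c` qubits are exchanged. The number of qubits is arbitrary;
`n` of Alice's qubits are designated for her input and `n` of Bob's qubits for his input. -/
structure Protocol (n c : ℕ) where
  /-- the total number of qubits -/
  m : ℕ
  /-- who possesses which qubit at the start -/
  own : Fin m → Player
  /-- the qubits that are initialized to Alice's input -/
  inputA : Fin n ↪ Fin m
  /-- the qubits that are initialized to Bob's input -/
  inputB : Fin n ↪ Fin m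
  own_inputA : ∀ i, own (inputA i) = Player.alice
  own_inputB : ∀ i, own (inputB i) = Player.bob
  /-- the rounds and the final measurement -/
  rounds : Rounds own c

/-- The classical bit string to which the qubits are initialized on the input `(x, y)`: the input
qubits hold `x` and `y`, all other qubits are `0`. -/
def Protocol.initialBits {n c : ℕ} (P : Protocol n c) (x y : Fin n → Bool) : Fin P.m → Bool :=
  fun q => decide ((∃ i, P.inputA i = q ∧ x i = true) ∨ (∃ i, P.inputB i = q ∧ y i = true))

/-- The probability that the protocol outputs the bit `v` on the input `(x, y)`. -/
noncomputable def Protocol.outputProb {n c : ℕ} (P : Protocol n c) (x y : Fin n → Bool)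
    (v : Bool) : ℝ :=
  P.rounds.outputProb (Pi.single (P.initialBits x y) 1) v

/-- The protocol computes `f` with error at most `ε`: on every input, the correct answer is given
with probability at least `1 - ε`. -/
def Protocol.Computes {n c : ℕ} (P : Protocol n c) (f : (Fin n → Bool) → (Fin n → Bool) → Bool)
    (ε : ℝ) : Prop :=
  ∀ x y, 1 - ε ≤ P.outputProb x y (f x y)

/-- The quantum communication complexity of `f` with error `ε`: the least number of qubits
exchanged in a protocol that computes `f` with error at most `ε` (`⊤` if there were none). -/
noncomputable def BQCWithError {n : ℕ} (ε : ℝ) (f : (Fin n → Bool) → (Fin n → Bool) → Bool) : ℕ∞ :=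
  ⨅ (c : ℕ) (_ : ∃ P : Protocol n c, P.Computes f ε), (c : ℕ∞)

/-- The bounded-error quantum communication complexity of `f`, with the error `1 / 3`. -/
noncomputable def BQC {n : ℕ} (f : (Fin n → Bool) → (Fin n → Bool) → Bool) : ℕ∞ :=
  BQCWithError (1 / 3) f

/-- The function `HAM_n^t`: it is `1` if and only if the Hamming distance of `x` and `y` is
different from `t`. -/
def HAM (n t : ℕ) (x y : Fin n → Bool) : Bool :=
  decide (hammingDist x y ≠ t)

end QuantumCommunication

namespace QuantumCommunication

/-! A protocol with `c` qubits of communication has output probabilities that are sums of `4 ^ c`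
products `a x * b y` with factors of modulus at most 1 (`Protocol.outputProb_eq_sum`). Let `p` be
the probability of output `false` and `n = 2k`. The unitary matrix `flatMatrix` has all entries of
modulus `2^(-k)`, and its entries at Hamming distance `k` are positive. Unitarity bounds its
correlation with any such product by `2 ^ n`, hence with `p ^ t` by `4 ^ (c t) * 2 ^ n`
(`norm_sum_pow_mul_flatMatrix_le`). On the other hand, `p` is at least `2/3` at distance `k` and at
most `1/3` elsewhere. Distance `k` has a fraction of at least `1 / (n + 1)` of all pairs, so a power
`t` of order `log n` makes these pairs outweigh all others. Comparing the two bounds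
(`pow_le_of_computes`) gives `k ≤ 2 t (c + 1)`, hence the theorem. -/

/-! ### Local unitaries and conservation of probability -/

theorem Player.eq_other_of_ne {p r : Player} (h : r ≠ p) : r = p.other := by
  cases p <;> cases r <;> simp_all [Player.other]

theorem Player.other_ne (p : Player) : p.other ≠ p := by
  cases p <;> simp [Player.other]

/-- Allows arguments about the acting player without distinguishing Alice from Bob. -/
theorem Player.mul_eq {R : Type*} [CommMonoid R] (f : Player → R) (p : Player) :
    f .alice * f .bob = f p * f p.other := by
  cases p
  · rfl
  · exact mul_comm _ _

/-- The part of a bit string that player `p` possesses. -/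
def restrict {m : ℕ} (own : Fin m → Player) (p : Player) (b : Fin m → Bool) : LocalBasis own p :=
  fun i => b i

theorem restrict_overwrite {m : ℕ} (own : Fin m → Player) (p : Player) (s : LocalBasis own p)
    (b : Fin m → Bool) : restrict own p (overwrite own p s b) = s := by
  funext i
  simp [restrict, overwrite, i.2]

theorem restrict_other_overwrite {m : ℕ} (own : Fin m → Player) (p : Player)
    (s : LocalBasis own p) (b : Fin m → Bool) :
    restrict own p.other (overwrite own p s b) = restrict own p.other b := by
  funext i
  have h : own i ≠ p := fun h => p.other_ne (i.2.symm.trans h)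
  simp [restrict, overwrite, h]

/-- A bit string consists of the parts of the two players. -/
def splitEquiv {m : ℕ} (own : Fin m → Player) (p : Player) :
    (Fin m → Bool) ≃ LocalBasis own p × LocalBasis own p.other where
  toFun b := (restrict own p b, restrict own p.other b)
  invFun st := fun j => if h : own j = p then st.1 ⟨j, h⟩ else st.2 ⟨j, Player.eq_other_of_ne h⟩
  left_inv b := by
    funext j
    by_cases h : own j = p <;> simp [restrict, h]
  right_inv st := by
    ext j
    · simp [restrict, j.2]
    · have h : own j ≠ p := fun h => p.other_ne (j.2.symm.trans h)
      simp [restrict, h]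

theorem sum_restrict_mul {m : ℕ} (own : Fin m → Player) (p : Player)
    (f : LocalBasis own p → ℂ) (g : LocalBasis own p.other → ℂ) :
    ∑ b : Fin m → Bool, f (restrict own p b) * g (restrict own p.other b) =
      (∑ s, f s) * ∑ t, g t := by
  rw [Finset.sum_mul_sum, ← Fintype.sum_prod_type']
  exact Fintype.sum_equiv (splitEquiv own p) _ _ fun b => rfl

theorem sum_norm_sq_mulVec {α : Type*} [Fintype α] [DecidableEq α]
    (U : Matrix.unitaryGroup α ℂ) (v : α → ℂ) :
    ∑ s, ‖(U.1.mulVec v) s‖ ^ 2 = ∑ s, ‖v s‖ ^ 2 := by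
  have key : ∀ w : α → ℂ, ((∑ s, ‖w s‖ ^ 2 : ℝ) : ℂ) = star w ⬝ᵥ w := fun w => by
    simp [dotProduct, Complex.conj_mul']
  have hU : star U.1 * U.1 = 1 := Matrix.mem_unitaryGroup_iff'.mp U.2
  rw [← Complex.ofReal_inj, key, key, Matrix.star_mulVec, Matrix.dotProduct_mulVec,
    Matrix.vecMul_vecMul, ← Matrix.star_eq_conjTranspose, hU, Matrix.vecMul_one]

theorem applyLocal_eq_mulVec {m : ℕ} (own : Fin m → Player) (p : Player)
    (U : Matrix (LocalBasis own p) (LocalBasis own p) ℂ) (ψ : State m)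
    (s : LocalBasis own p) (t : LocalBasis own p.other) :
    applyLocal own p U ψ ((splitEquiv own p).symm (s, t)) =
      (U.mulVec fun s' => ψ ((splitEquiv own p).symm (s', t))) s := by
  have hr : restrict own p ((splitEquiv own p).symm (s, t)) = s :=
    congrArg Prod.fst ((splitEquiv own p).apply_symm_apply (s, t))
  have hr' : restrict own p.other ((splitEquiv own p).symm (s, t)) = t :=
    congrArg Prod.snd ((splitEquiv own p).apply_symm_apply (s, t))
  refine Finset.sum_congr rfl fun s' _ => ?_
  have h : overwrite own p s' ((splitEquiv own p).symm (s, t)) =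
      (splitEquiv own p).symm (s', t) := by
    rw [Equiv.eq_symm_apply]
    exact Prod.ext (restrict_overwrite own p s' _) ((restrict_other_overwrite own p s' _).trans hr')
  rw [h]
  exact congrArg (fun z => U z s' * _) hr

theorem sum_norm_sq_applyLocal {m : ℕ} (own : Fin m → Player) (p : Player)
    (U : Matrix.unitaryGroup (LocalBasis own p) ℂ) (ψ : State m) :
    ∑ b, ‖applyLocal own p U.1 ψ b‖ ^ 2 = ∑ b, ‖ψ b‖ ^ 2 := by
  rw [← (splitEquiv own p).symm.sum_comp, ← (splitEquiv own p).symm.sum_comp fun b => ‖ψ b‖ ^ 2,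
    Fintype.sum_prod_type_right, Fintype.sum_prod_type_right]
  refine Finset.sum_congr rfl fun t _ => ?_
  simp_rw [applyLocal_eq_mulVec]
  exact sum_norm_sq_mulVec U _

theorem Rounds.outputProb_add {m : ℕ} {own : Fin m → Player} {c : ℕ} (R : Rounds own c)
    (ψ : State m) : R.outputProb ψ true + R.outputProb ψ false = ∑ b, ‖ψ b‖ ^ 2 := by
  induction R generalizing ψ with
  | measure out =>
    rw [outputProb, outputProb, ← Finset.sum_add_distrib]
    refine Finset.sum_congr rfl fun b _ => ?_
    cases b out <;> simp
  | round p U q hq rest ih =>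
    rw [outputProb, outputProb, ih, sum_norm_sq_applyLocal]

theorem Rounds.outputProb_nonneg {m : ℕ} {own : Fin m → Player} {c : ℕ} (R : Rounds own c)
    (ψ : State m) (v : Bool) : 0 ≤ R.outputProb ψ v := by
  induction R generalizing ψ with
  | measure out => exact Finset.sum_nonneg fun b _ => by split_ifs <;> positivity
  | round p U q hq rest ih => exact ih _

theorem Protocol.outputProb_add {n c : ℕ} (P : Protocol n c) (x y : Fin n → Bool) :
    P.outputProb x y true + P.outputProb x y false = 1 := by
  rw [Protocol.outputProb, Protocol.outputProb, Rounds.outputProb_add,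
    Finset.sum_eq_single (P.initialBits x y)]
  · simp
  · intro b _ hb
    simp [Pi.single_eq_of_ne hb]
  · simp

/-! ### Decomposition of the output probability into products -/

/-- A family of global states, indexed by the inputs `w p` of the players `p`, that is a sum of
`K` products of a subnormalized state of Alice, which depends on her input only, and one of Bob,
which depends on his input only. -/
def IsProductSum {m : ℕ} {X : Type} (own : Fin m → Player) (K : ℕ)
    (Ψ : (Player → X) → State m) : Prop :=
  ∃ (ι : Type) (_ : Fintype ι) (F : ∀ p, ι → X → LocalBasis own p → ℂ),
    Fintype.card ι = K ∧ (∀ p i x, ∑ s, ‖F p i x s‖ ^ 2 ≤ 1) ∧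
    ∀ w b, Ψ w b = ∑ i, F .alice i (w .alice) (restrict own .alice b) *
      F .bob i (w .bob) (restrict own .bob b)

theorem IsProductSum.applyLocal {m : ℕ} {X : Type} {own : Fin m → Player} {K : ℕ}
    {Ψ : (Player → X) → State m} (h : IsProductSum own K Ψ) (p : Player)
    (U : Matrix.unitaryGroup (LocalBasis own p) ℂ) :
    IsProductSum own K fun w => QuantumCommunication.applyLocal own p U.1 (Ψ w) := by
  obtain ⟨ι, _, F, hK, hF, hΨ⟩ := h
  refine ⟨ι, inferInstance,
    Function.update F p fun i x => U.1.mulVec (F p i x), hK, fun r i x => ?_, fun w b => ?_⟩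
  · by_cases hr : r = p
    · subst hr
      rw [Function.update_self, sum_norm_sq_mulVec]
      exact hF r i x
    · rw [Function.update_of_ne hr]
      exact hF r i x
  · have hΨ' : ∀ b, Ψ w b = ∑ i, F p i (w p) (restrict own p b) *
        F p.other i (w p.other) (restrict own p.other b) := fun b => by
      rw [hΨ]
      exact Finset.sum_congr rfl fun i _ =>
        Player.mul_eq (fun r => F r i (w r) (restrict own r b)) p
    have hR : ∀ i, Function.update F p (fun i x => U.1.mulVec (F p i x)) .alice i (w .alice)
          (restrict own .alice b) *
        Function.update F p (fun i x => U.1.mulVec (F p i x)) .bob i (w .bob)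
          (restrict own .bob b) =
        (U.1.mulVec (F p i (w p))) (restrict own p b) *
          F p.other i (w p.other) (restrict own p.other b) := fun i => by
      rw [Player.mul_eq (fun r => Function.update F p (fun i x => U.1.mulVec (F p i x)) r i (w r)
          (restrict own r b)) p, Function.update_self, Function.update_of_ne p.other_ne]
    simp_rw [hR, QuantumCommunication.applyLocal, hΨ', restrict_overwrite,
      restrict_other_overwrite, Matrix.mulVec, dotProduct, Finset.mul_sum, Finset.sum_mul]
    rw [Finset.sum_comm]
    simp_rw [← mul_assoc]
    rfl

open Classical in
-- Each product is split according to the value `v` of the sent qubit: a player without `q` has `v`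
-- plugged into his factor, and the new owner's factor is set to zero unless `q` holds `v`. Neither
-- operation increases a norm.
theorem IsProductSum.send {m : ℕ} {X : Type} {own own' : Fin m → Player} {K : ℕ}
    {Ψ : (Player → X) → State m} (h : IsProductSum own K Ψ) (q : Fin m)
    (hown : ∀ j, j ≠ q → own' j = own j) : IsProductSum own' (K * 2) Ψ := by
  obtain ⟨ι, _, F, hK, hF, hΨ⟩ := h
  let ext (r : Player) (v : Bool) (s : LocalBasis own' r) : LocalBasis own r :=
    fun j => if h : own' j = r then s ⟨j, h⟩ else v
  let ok (r : Player) (v : Bool) (s : LocalBasis own' r) : Prop :=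
    ∀ h : own' q = r, s ⟨q, h⟩ = v
  refine ⟨ι × Bool, inferInstance, fun r iv x s =>
    if ok r iv.2 s then F r iv.1 x (ext r iv.2 s) else 0, ?_, ?_, ?_⟩
  · simp [hK]
  · rintro r ⟨i, v⟩ x
    have hinj : Set.InjOn (ext r v) (Finset.univ.filter (ok r v) : Finset _) := by
      intro s hs s' hs' hss
      simp only [Finset.coe_filter, Finset.mem_univ, true_and, Set.mem_ofPred_eq] at hs hs'
      funext ⟨j, hj⟩
      by_cases hjq : j = q
      · subst hjq
        exact (hs hj).trans (hs' hj).symm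
      · have := congrFun hss ⟨j, (hown j hjq).symm.trans hj⟩
        simpa [ext, hj] using this
    calc ∑ s, ‖if ok r v s then F r i x (ext r v s) else 0‖ ^ 2
        = ∑ s ∈ Finset.univ.filter (ok r v), ‖F r i x (ext r v s)‖ ^ 2 := by
          rw [Finset.sum_filter]
          exact Finset.sum_congr rfl fun s _ => by split_ifs <;> simp
      _ = ∑ s ∈ (Finset.univ.filter (ok r v)).image (ext r v), ‖F r i x s‖ ^ 2 :=
          (Finset.sum_image (f := fun s => ‖F r i x s‖ ^ 2) hinj).symm
      _ ≤ ∑ s, ‖F r i x s‖ ^ 2 :=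
          Finset.sum_le_sum_of_subset_of_nonneg (Finset.subset_univ _) fun _ _ _ => by positivity
      _ ≤ 1 := hF r i x
  · intro w b
    rw [hΨ, Fintype.sum_prod_type]
    refine Finset.sum_congr rfl fun i _ => ?_
    have hext : ∀ r, ext r (b q) (restrict own' r b) = restrict own r b := fun r => by
      funext ⟨j, hj⟩
      by_cases h : own' j = r
      · simp [ext, h, restrict]
      · have : j = q := by
          by_contra hjq
          exact h ((hown j hjq).trans hj)
        subst this
        simp [ext, h, restrict]
    have hok : ∀ r, ok r (b q) (restrict own' r b) := fun r _ => rfl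
    -- Only the value that `q` has in `b` survives the owner's test.
    rw [Finset.sum_eq_single (b q)]
    · simp [hok, hext]
    · intro v _ hv
      have hno : ¬ ok (own' q) v (restrict own' (own' q) b) := fun h => hv (h rfl).symm
      rw [Player.mul_eq (fun r => if ok r v (restrict own' r b) then
        F r i (w r) (ext r v (restrict own' r b)) else 0) (own' q), if_neg hno, zero_mul]
    · simp

theorem norm_sum_mul_conj_le {α : Type*} [Fintype α] (f g : α → ℂ) (u : α → Prop)
    [DecidablePred u] (hf : ∑ s, ‖f s‖ ^ 2 ≤ 1) (hg : ∑ s, ‖g s‖ ^ 2 ≤ 1) :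
    ‖∑ s, if u s then f s * starRingEnd ℂ (g s) else 0‖ ≤ 1 := by
  calc ‖∑ s, if u s then f s * starRingEnd ℂ (g s) else 0‖
      ≤ ∑ s, ‖f s‖ * ‖g s‖ := norm_sum_le_of_le _ fun s _ => by
        split_ifs
        · simp
        · simp only [norm_zero]; positivity
    _ ≤ ∑ s, (‖f s‖ ^ 2 / 2 + ‖g s‖ ^ 2 / 2) := Finset.sum_le_sum fun s _ => by
        nlinarith [sq_nonneg (‖f s‖ - ‖g s‖)]
    _ ≤ 1 := by
        rw [Finset.sum_add_distrib, ← Finset.sum_div, ← Finset.sum_div]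
        linarith

open Classical in
/-- The probability of an output, as a function of the inputs, is a sum of few products. -/
theorem Rounds.outputProb_eq_sum {m : ℕ} {X : Type} {own : Fin m → Player} {c : ℕ}
    (R : Rounds own c) (K : ℕ) (Ψ : (Player → X) → State m) (h : IsProductSum own K Ψ) (v : Bool) :
    ∃ (κ : Type) (_ : Fintype κ) (a : Player → κ → X → ℂ),
      Fintype.card κ = (K * 2 ^ c) ^ 2 ∧ (∀ p k x, ‖a p k x‖ ≤ 1) ∧
      ∀ w, (R.outputProb (Ψ w) v : ℂ) = ∑ k, a .alice k (w .alice) * a .bob k (w .bob) := by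
  induction R generalizing K Ψ with
  | @measure own out =>
    obtain ⟨ι, _, F, hK, hF, hΨ⟩ := h
    let ok (r : Player) (s : LocalBasis own r) : Prop := ∀ h : own out = r, s ⟨out, h⟩ = v
    -- Expanding the squared modulus of an amplitude pairs the products, which squares their number.
    -- The condition on the measured qubit is imposed in the factor of its owner alone.
    refine ⟨ι × ι, inferInstance, fun r ij x => ∑ s, if ok r s then
      F r ij.1 x s * starRingEnd ℂ (F r ij.2 x s) else 0, ?_, ?_, ?_⟩
    · simp [hK, sq]
    · exact fun p k x => norm_sum_mul_conj_le _ _ _ (hF _ _ _) (hF _ _ _)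
    · intro w
      refine Eq.trans ?_ (Finset.sum_congr rfl fun k _ => sum_restrict_mul own .alice _ _)
      rw [Finset.sum_comm, outputProb]
      push_cast
      refine Finset.sum_congr rfl fun b _ => ?_
      have hprod : ∀ k : ι × ι, (if ok .alice (restrict own .alice b) then
            F .alice k.1 (w .alice) (restrict own .alice b) *
              starRingEnd ℂ (F .alice k.2 (w .alice) (restrict own .alice b)) else 0) *
          (if ok .bob (restrict own .bob b) then
            F .bob k.1 (w .bob) (restrict own .bob b) *
              starRingEnd ℂ (F .bob k.2 (w .bob) (restrict own .bob b)) else 0) =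
          if b out = v then
            (F .alice k.1 (w .alice) (restrict own .alice b) *
              F .bob k.1 (w .bob) (restrict own .bob b)) *
            starRingEnd ℂ (F .alice k.2 (w .alice) (restrict own .alice b) *
              F .bob k.2 (w .bob) (restrict own .bob b)) else 0 := fun k => by
        by_cases hb : b out = v
        · have hok : ∀ r, ok r (restrict own r b) := fun r _ => hb
          rw [if_pos (hok _), if_pos (hok _), if_pos hb, map_mul]
          ring
        · have hno : ¬ ok (own out) (restrict own (own out) b) := fun h => hb (h rfl)
          rw [if_neg hb, Player.mul_eq (fun r => if ok r (restrict own r b) then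
            F r k.1 (w r) (restrict own r b) *
              starRingEnd ℂ (F r k.2 (w r) (restrict own r b)) else 0) (own out), if_neg hno,
            zero_mul]
      refine Eq.trans ?_ (Finset.sum_congr rfl fun k _ => (hprod k).symm)
      by_cases hb : b out = v
      · simp only [hb, if_true]
        rw [Fintype.sum_prod_type]
        dsimp only
        rw [← Finset.sum_mul_sum, ← map_sum, ← hΨ, Complex.mul_conj']
        norm_cast
      · simp [hb]
  | @round own c p U q hq rest ih =>
    obtain ⟨κ, i, a, hκ, ha⟩ := ih (K * 2) _
      ((h.applyLocal p U).send q fun j hj => Function.update_of_ne hj _ _)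
    exact ⟨κ, i, a, by rw [hκ, pow_succ]; ring, ha⟩

theorem Protocol.isProductSum_initial {n c : ℕ} (P : Protocol n c) :
    IsProductSum P.own 1 fun w : Player → Fin n → Bool =>
      (Pi.single (P.initialBits (w .alice) (w .bob)) 1 : State P.m) := by
  -- The part of `p` does not see the partner's input, so his own input may stand in for both.
  have hloc : ∀ (p : Player) (w : Player → Fin n → Bool),
      restrict P.own p (P.initialBits (w .alice) (w .bob)) =
        restrict P.own p (P.initialBits (w p) (w p)) := by
    intro p w
    funext ⟨j, hj⟩
    have hA : ∀ x : Fin n → Bool, (∃ i, P.inputA i = j ∧ x i = true) → p = .alice :=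
      fun x ⟨i, hi, _⟩ => by rw [← hj, ← hi, P.own_inputA]
    have hB : ∀ x : Fin n → Bool, (∃ i, P.inputB i = j ∧ x i = true) → p = .bob :=
      fun x ⟨i, hi, _⟩ => by rw [← hj, ← hi, P.own_inputB]
    simp only [restrict, initialBits, decide_eq_decide]
    cases p
    · exact or_congr Iff.rfl ⟨fun h => (nomatch hB _ h), fun h => (nomatch hB _ h)⟩
    · exact or_congr ⟨fun h => (nomatch hA _ h), fun h => (nomatch hA _ h)⟩ Iff.rfl
  refine ⟨Unit, inferInstance,
    fun p _ x => Pi.single (restrict P.own p (P.initialBits x x)) 1, rfl, fun p _ x => ?_,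
    fun w b => ?_⟩
  · rw [Finset.sum_eq_single (restrict P.own p (P.initialBits x x))]
    · simp
    · intro b _ hb
      simp [Pi.single_eq_of_ne hb]
    · simp
  · simp only [← hloc, Finset.univ_unique, Finset.sum_singleton, Pi.single_apply]
    by_cases hb : b = P.initialBits (w .alice) (w .bob)
    · simp [hb]
    · have : ¬ (restrict P.own .alice b =
            restrict P.own .alice (P.initialBits (w .alice) (w .bob)) ∧
          restrict P.own .bob b = restrict P.own .bob (P.initialBits (w .alice) (w .bob))) :=
        fun h => hb ((splitEquiv P.own .alice).injective (Prod.ext h.1 h.2))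
      rw [if_neg hb]
      split_ifs <;> simp_all

theorem Protocol.outputProb_eq_sum {n c : ℕ} (P : Protocol n c) (v : Bool) :
    ∃ (κ : Type) (_ : Fintype κ) (a b : κ → (Fin n → Bool) → ℂ),
      Fintype.card κ = 4 ^ c ∧ (∀ k x, ‖a k x‖ ≤ 1) ∧ (∀ k y, ‖b k y‖ ≤ 1) ∧
      ∀ x y, (P.outputProb x y v : ℂ) = ∑ k, a k x * b k y := by
  obtain ⟨κ, i, a, hκ, ha, h⟩ := P.rounds.outputProb_eq_sum 1 _ P.isProductSum_initial v
  refine ⟨κ, i, a .alice, a .bob, ?_, ha _, ha _, fun x y =>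
    h fun | .alice => x | .bob => y⟩
  rw [hκ, one_mul, ← pow_mul, mul_comm, pow_mul]
  norm_num

/-! ### The flat unitary matrix and its correlation with products -/

/-- The `n`-fold tensor power of the unitary matrix with the entries `(1 + i) / 2` on the diagonal
and `(1 - i) / 2` off the diagonal. -/
noncomputable def flatMatrix (n : ℕ) : Matrix (Fin n → Bool) (Fin n → Bool) ℂ :=
  fun x y => ∏ i, if x i = y i then (1 + Complex.I) / 2 else (1 - Complex.I) / 2

/-- The inner product of two rows factors over the coordinates, which leaves the `2 × 2` case `h1`.
-/
theorem flatMatrix_mem_unitaryGroup (n : ℕ) :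
    flatMatrix n ∈ Matrix.unitaryGroup (Fin n → Bool) ℂ := by
  rw [Matrix.mem_unitaryGroup_iff]
  ext x x'
  have hI : Complex.I ^ 2 = -1 := Complex.I_sq
  have h1 : ∀ b b' : Bool, ∑ z : Bool, (if b = z then (1 + Complex.I) / 2 else (1 - Complex.I) / 2) *
      starRingEnd ℂ (if b' = z then (1 + Complex.I) / 2 else (1 - Complex.I) / 2) =
        if b = b' then 1 else 0 := by
    intro b b'
    cases b <;> cases b' <;> simp [map_ofNat] <;>
      first
      | linear_combination (-1 / 2 : ℂ) * hI
      | linear_combination (1 / 2 : ℂ) * hI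
  rw [Matrix.mul_apply]
  simp only [Matrix.star_apply, flatMatrix, RCLike.star_def, map_prod, ← Finset.prod_mul_distrib]
  rw [← Fintype.prod_sum fun i z => (if x i = z then (1 + Complex.I) / 2 else (1 - Complex.I) / 2) *
      starRingEnd ℂ (if x' i = z then (1 + Complex.I) / 2 else (1 - Complex.I) / 2)]
  simp only [h1, Matrix.one_apply, funext_iff]
  rw [Fintype.prod_ite_zero]
  simp

theorem norm_flatMatrix (k : ℕ) (x y : Fin (2 * k) → Bool) :
    ‖flatMatrix (2 * k) x y‖ = (1 / 2) ^ k := by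
  have h : ∀ i, ‖if x i = y i then (1 + Complex.I) / 2 else (1 - Complex.I) / 2‖ ^ 2 = 1 / 2 := by
    intro i
    split_ifs <;> rw [← Complex.normSq_eq_norm_sq] <;> simp [Complex.normSq_apply] <;> norm_num
  have h2 : ‖flatMatrix (2 * k) x y‖ ^ 2 = ((1 / 2) ^ k) ^ 2 := by
    rw [flatMatrix, norm_prod, ← Finset.prod_pow, Finset.prod_congr rfl fun i _ => h i]
    simp [← pow_mul, mul_comm]
  exact (pow_left_inj₀ (norm_nonneg _) (by positivity) two_ne_zero).mp h2

/-- Equally many factors of both kinds occur, and `(1 + i)(1 - i) / 4 = 1/2`, so the phases cancel.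
-/
theorem flatMatrix_of_hammingDist_eq (k : ℕ) (x y : Fin (2 * k) → Bool)
    (h : hammingDist x y = k) : flatMatrix (2 * k) x y = (1 / 2) ^ k := by
  have h1 : (Finset.univ.filter fun i => ¬ x i = y i).card = k := h
  have h2 : (Finset.univ.filter fun i => x i = y i).card = k := by
    have := Finset.card_filter_add_card_filter_not (s := Finset.univ) fun i => x i = y i
    rw [h1, Finset.card_univ, Fintype.card_fin] at this
    omega
  rw [flatMatrix, Finset.prod_ite, Finset.prod_const, Finset.prod_const, h1, h2, ← mul_pow]
  congr 1
  linear_combination (-1 / 4 : ℂ) * Complex.I_sq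

/-- Both vectors have squared norm at most `2 ^ n`, and the unitary matrix preserves that of `b`. -/
theorem norm_sum_mul_flatMatrix_le {n : ℕ} (a b : (Fin n → Bool) → ℂ) (ha : ∀ x, ‖a x‖ ≤ 1)
    (hb : ∀ y, ‖b y‖ ≤ 1) : ‖∑ x, ∑ y, a x * b y * flatMatrix n x y‖ ≤ 2 ^ n := by
  have hsum : ∀ f : (Fin n → Bool) → ℂ, (∀ x, ‖f x‖ ≤ 1) → ∑ x, ‖f x‖ ^ 2 ≤ 2 ^ n := by
    intro f hf
    refine (Finset.sum_le_card_nsmul _ _ 1 fun x _ => pow_le_one₀ (norm_nonneg _) (hf x)).trans ?_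
    simp
  have hU := sum_norm_sq_mulVec ⟨flatMatrix n, flatMatrix_mem_unitaryGroup n⟩ b
  have heq : ∑ x, ∑ y, a x * b y * flatMatrix n x y = ∑ x, a x * ((flatMatrix n).mulVec b) x := by
    refine Finset.sum_congr rfl fun x _ => ?_
    rw [Matrix.mulVec, dotProduct, Finset.mul_sum]
    exact Finset.sum_congr rfl fun y _ => by ring
  rw [heq]
  calc ‖∑ x, a x * ((flatMatrix n).mulVec b) x‖
      ≤ ∑ x, (‖a x‖ ^ 2 / 2 + ‖((flatMatrix n).mulVec b) x‖ ^ 2 / 2) :=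
        norm_sum_le_of_le _ fun x _ => by
          rw [norm_mul]
          nlinarith [sq_nonneg (‖a x‖ - ‖((flatMatrix n).mulVec b) x‖)]
    _ ≤ 2 ^ n := by
        rw [Finset.sum_add_distrib, ← Finset.sum_div, ← Finset.sum_div]
        linarith [hsum a ha, hsum b hb]

/-- The `t`-th power expands into `card κ ^ t` products of the same bounded kind. -/
theorem norm_sum_pow_mul_flatMatrix_le {n : ℕ} {κ : Type} [Fintype κ]
    (a b : κ → (Fin n → Bool) → ℂ) (ha : ∀ k x, ‖a k x‖ ≤ 1) (hb : ∀ k y, ‖b k y‖ ≤ 1) (t : ℕ) :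
    ‖∑ x, ∑ y, (∑ k, a k x * b k y) ^ t * flatMatrix n x y‖ ≤ Fintype.card κ ^ t * 2 ^ n := by
  have hprod : ∀ f : κ → (Fin n → Bool) → ℂ, (∀ k x, ‖f k x‖ ≤ 1) → ∀ (g : Fin t → κ) x,
      ‖∏ i, f (g i) x‖ ≤ 1 := fun f hf g x => by
    rw [norm_prod]
    exact Finset.prod_le_one (fun _ _ => norm_nonneg _) fun i _ => hf _ _
  have heq : ∑ x, ∑ y, (∑ k, a k x * b k y) ^ t * flatMatrix n x y =
      ∑ g : Fin t → κ, ∑ x, ∑ y, (∏ i, a (g i) x) * (∏ i, b (g i) y) * flatMatrix n x y := by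
    refine Eq.trans (Finset.sum_congr rfl fun x _ => ?_) Finset.sum_comm
    refine Eq.trans ?_ Finset.sum_comm
    refine Finset.sum_congr rfl fun y _ => ?_
    rw [Fintype.sum_pow, Finset.sum_mul]
    simp_rw [Finset.prod_mul_distrib]
  rw [heq]
  refine (norm_sum_le_of_le _ fun g _ => norm_sum_mul_flatMatrix_le _ _ (hprod a ha g)
    (hprod b hb g)).trans_eq ?_
  simp

/-! ### Amplification and the lower bound -/

theorem card_hammingDist_eq (n k : ℕ) (x : Fin n → Bool) :
    (Finset.univ.filter fun y => hammingDist x y = k).card = n.choose k := by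
  rw [show n.choose k = (Finset.powersetCard k (Finset.univ : Finset (Fin n))).card by simp]
  refine Finset.card_bij' (fun y _ => Finset.univ.filter fun i => x i ≠ y i)
    (fun S _ i => xor (x i) (decide (i ∈ S))) ?_ ?_ ?_ ?_
  · intro y hy
    simpa [Finset.mem_powersetCard, hammingDist] using hy
  · intro S hS
    have : (Finset.univ.filter fun i => x i ≠ xor (x i) (decide (i ∈ S))) = S := by
      ext i
      by_cases hi : i ∈ S <;> cases hx : x i <;> simp [hi, hx]
    simpa [hammingDist, this, Finset.mem_powersetCard] using hS
  · intro y _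
    funext i
    cases hx : x i <;> cases hy : y i <;> simp [hx, hy]
  · intro S _
    ext i
    by_cases hi : i ∈ S <;> cases hx : x i <;> simp [hi, hx]

theorem pow_le_of_computes {k c : ℕ} (P : Protocol (2 * k) c)
    (hP : P.Computes (HAM (2 * k) k) (1 / 3)) (t : ℕ) :
    (2 : ℝ) ^ k * (1 / (2 * k + 1) - (1 / 2) ^ t) ≤ (3 / 2 * 4 ^ c) ^ t := by
  obtain ⟨κ, _, a, b, hκ, ha, hb, hab⟩ := P.outputProb_eq_sum false
  have hU := norm_sum_pow_mul_flatMatrix_le a b ha hb t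
  simp_rw [← hab, hκ] at hU
  -- Scaling by `3/2` turns the thresholds `2/3` and `1/3` into `1` and `1/2`. At distance `k` the
  -- entry is positive; elsewhere its phase is unknown, and the worst case costs `(1/2)^t` times its
  -- modulus.
  have hterm : ∀ x y, (1 / 2 : ℝ) ^ k * ((if hammingDist x y = k then 1 else 0) - (1 / 2) ^ t) ≤
      (3 / 2) ^ t * ((P.outputProb x y false : ℂ) ^ t * flatMatrix (2 * k) x y).re := by
    intro x y
    have hc := hP x y
    have h0 : 0 ≤ P.outputProb x y false := P.rounds.outputProb_nonneg _ _
    have hpos : (0 : ℝ) < (1 / 2) ^ k := by positivity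
    by_cases h : hammingDist x y = k
    · have hf : HAM (2 * k) k x y = false := by simp [HAM, h]
      rw [hf] at hc
      have hre : ((P.outputProb x y false : ℂ) ^ t * flatMatrix (2 * k) x y).re =
          P.outputProb x y false ^ t * (1 / 2) ^ k := by
        rw [flatMatrix_of_hammingDist_eq k x y h, ← Complex.ofReal_re (_ * _)]
        push_cast
        rfl
      have h1 : 1 ≤ (3 / 2 * P.outputProb x y false) ^ t := one_le_pow₀ (by linarith)
      have h2 : (0 : ℝ) ≤ (1 / 2) ^ t := by positivity
      rw [if_pos h, hre, ← mul_assoc, ← mul_pow, mul_comm]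
      exact mul_le_mul_of_nonneg_right (by linarith) hpos.le
    · have hf : HAM (2 * k) k x y = true := by simp [HAM, h]
      rw [hf] at hc
      have hadd := P.outputProb_add x y
      have h1 : (3 / 2 * P.outputProb x y false) ^ t ≤ (1 / 2) ^ t :=
        pow_le_pow_left₀ (by positivity) (by linarith) t
      have h2 := (abs_le.mp (Complex.abs_re_le_norm
        ((P.outputProb x y false : ℂ) ^ t * flatMatrix (2 * k) x y))).1
      rw [norm_mul, norm_pow, Complex.norm_real, Real.norm_of_nonneg h0, norm_flatMatrix] at h2
      have h3 := mul_le_mul_of_nonneg_left h2 (by positivity : (0 : ℝ) ≤ (3 / 2) ^ t)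
      rw [mul_pow] at h1
      have h4 := mul_le_mul_of_nonneg_right h1 hpos.le
      rw [if_neg h]
      linarith
  have hcount : ∑ x : Fin (2 * k) → Bool, ∑ y, (1 / 2 : ℝ) ^ k *
      ((if hammingDist x y = k then 1 else 0) - (1 / 2) ^ t) =
      (1 / 2) ^ k * (4 ^ k * ((2 * k).choose k - 4 ^ k * (1 / 2) ^ t)) := by
    have hx : ∀ x : Fin (2 * k) → Bool, ∑ y, (1 / 2 : ℝ) ^ k *
        ((if hammingDist x y = k then 1 else 0) - (1 / 2) ^ t) =
        (1 / 2) ^ k * ((2 * k).choose k - 4 ^ k * (1 / 2) ^ t) := by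
      intro x
      rw [← Finset.mul_sum, Finset.sum_sub_distrib, Finset.sum_boole, card_hammingDist_eq]
      norm_num [pow_mul]
    rw [Finset.sum_congr rfl fun x _ => hx x]
    norm_num [pow_mul]
    ring
  have hle : (1 / 2 : ℝ) ^ k * (4 ^ k * ((2 * k).choose k - 4 ^ k * (1 / 2) ^ t)) ≤
      (3 / 2) ^ t * ((4 ^ c) ^ t * 4 ^ k) := by
    rw [← hcount]
    refine (Finset.sum_le_sum fun x _ => Finset.sum_le_sum fun y _ => hterm x y).trans ?_
    simp_rw [← Finset.mul_sum]
    refine mul_le_mul_of_nonneg_left ?_ (by positivity)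
    have h := (Complex.re_le_norm _).trans hU
    simp only [Complex.re_sum] at h
    refine h.trans_eq ?_
    rw [pow_mul]
    norm_num
  have hchoose : (4 : ℝ) ^ k * (1 / (2 * k + 1)) ≤ (2 * k).choose k := by
    have h := Nat.four_pow_le_two_mul_add_one_mul_central_binom k
    rw [mul_one_div, div_le_iff₀ (by positivity), mul_comm]
    exact_mod_cast h
  have h4 : (4 : ℝ) ^ k = 2 ^ k * 2 ^ k := by rw [← mul_pow]; norm_num
  have h2 : (1 / 2 : ℝ) ^ k * 2 ^ k = 1 := by rw [← mul_pow]; norm_num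
  have hpos : (0 : ℝ) < 4 ^ k := by positivity
  refine le_of_mul_le_mul_right ?_ hpos
  calc (2 : ℝ) ^ k * (1 / (2 * k + 1) - (1 / 2) ^ t) * 4 ^ k
      = (1 / 2) ^ k * (4 ^ k * (4 ^ k * (1 / (2 * k + 1)) - 4 ^ k * (1 / 2) ^ t)) := by
        linear_combination (-(1 / (2 * (k : ℝ) + 1) - (1 / 2) ^ t) * 4 ^ k * 2 ^ k) * h2 -
          ((1 / 2) ^ k * 4 ^ k * (1 / (2 * (k : ℝ) + 1) - (1 / 2) ^ t)) * h4
    _ ≤ (1 / 2) ^ k * (4 ^ k * ((2 * k).choose k - 4 ^ k * (1 / 2) ^ t)) := by gcongr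
    _ ≤ (3 / 2) ^ t * ((4 ^ c) ^ t * 4 ^ k) := hle
    _ = (3 / 2 * 4 ^ c) ^ t * 4 ^ k := by ring

theorem le_mul_of_computes {k c : ℕ} (hk : 0 < k) (P : Protocol (2 * k) c)
    (hP : P.Computes (HAM (2 * k) k) (1 / 3)) :
    2 * k ≤ 4 * (Nat.log 2 (2 * k) + 3) * (c + 1) := by
  -- With this `t`, the amplified error `2^(-t)` is at most half of `1 / (2k + 1)`, so the gap is
  -- still at least `2^(-t)`.
  set t := Nat.log 2 (2 * k) + 3 with ht
  have hlog : 2 * (2 * k + 1) ≤ 2 ^ t := by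
    have := Nat.lt_pow_succ_log_self (b := 2) one_lt_two (2 * k)
    rw [ht, pow_add]
    rw [Nat.succ_eq_add_one, pow_add] at this
    omega
  have hlog' : 2 * (2 * (k : ℝ) + 1) ≤ 2 ^ t := by exact_mod_cast hlog
  have h := pow_le_of_computes P hP t
  have hgap : (1 / 2 : ℝ) ^ t ≤ 1 / (2 * k + 1) - (1 / 2) ^ t := by
    have : (1 / 2 : ℝ) ^ t ≤ 1 / (2 * (2 * k + 1)) := by
      rw [one_div_pow]
      exact one_div_le_one_div_of_le (by positivity) hlog'
    have h2 : 1 / (2 * (k : ℝ) + 1) = 1 / (2 * (2 * k + 1)) + 1 / (2 * (2 * k + 1)) := by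
      field_simp
      norm_num
    linarith
  have hmain : (2 : ℝ) ^ k ≤ 2 ^ (2 * t * (c + 1)) := by
    have h1 : (2 : ℝ) ^ k * (1 / 2) ^ t ≤ (3 / 2 * 4 ^ c) ^ t :=
      (mul_le_mul_of_nonneg_left hgap (by positivity)).trans h
    calc (2 : ℝ) ^ k = 2 ^ t * (2 ^ k * (1 / 2) ^ t) := by
          rw [mul_left_comm, ← mul_pow]
          norm_num
      _ ≤ 2 ^ t * (3 / 2 * 4 ^ c) ^ t := by gcongr
      _ = (3 * 4 ^ c) ^ t := by rw [← mul_pow]; ring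
      _ ≤ (4 * 4 ^ c) ^ t := by gcongr; norm_num
      _ = 2 ^ (2 * t * (c + 1)) := by
          rw [show (4 : ℝ) = 2 ^ 2 by norm_num, ← pow_mul, ← pow_add, ← pow_mul]
          congr 1
          ring
  have := (pow_le_pow_iff_right₀ (one_lt_two : (1 : ℝ) < 2)).mp hmain
  linarith

end QuantumCommunication

/-! ### The asymptotic bound -/

theorem theorem5p2 :
    ∃ C : ℝ, 0 < C ∧ ∃ N : ℕ, ∀ n : ℕ, N ≤ n → Even n →
      ENNReal.ofReal (C * ((n : ℝ) / Real.logb 2 (n : ℝ))) ≤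
        ((QuantumCommunication.BQC (QuantumCommunication.HAM n (n / 2)) : ℕ∞) : ℝ≥0∞) := by
  -- The constant yields `32 * log₂ n ≤ n`. This absorbs the `+ 1` in `n ≤ 16 * log₂ n * (c + 1)` at
  -- the price of a factor 2, whence `C = 1 / 32`.
  have hlittle : ∀ᶠ n : ℕ in Filter.atTop, ‖Real.log n‖ ≤ Real.log 2 / 32 * ‖(n : ℝ)‖ :=
    (Real.isLittleO_log_id_atTop.comp_tendsto tendsto_natCast_atTop_atTop).bound
      (by have := Real.log_pos one_lt_two; positivity)
  obtain ⟨N, hN⟩ := Filter.eventually_atTop.mp hlittle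
  refine ⟨1 / 32, by norm_num, max N 2, fun n hn heven => ?_⟩
  obtain ⟨k, rfl⟩ := heven.two_dvd
  have hk : 0 < k := by have := le_of_max_le_right hn; omega
  rw [Nat.mul_div_cancel_left k two_pos]
  set n := 2 * k with hndef
  have hn2 : 2 ≤ n := le_of_max_le_right hn
  set L := Real.logb 2 n with hL
  have hlog2 : 0 < Real.log 2 := Real.log_pos one_lt_two
  have hL1 : 1 ≤ L := by
    rw [hL, Real.le_logb_iff_rpow_le one_lt_two (by positivity)]
    simpa using (by exact_mod_cast hn2 : (2 : ℝ) ≤ n)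
  have hLn : 32 * L ≤ n := by
    have h := hN n (le_of_max_le_left hn)
    rw [Real.norm_natCast, Real.norm_of_nonneg (Real.log_natCast_nonneg n)] at h
    rw [hL, Real.logb, ← mul_div_assoc, div_le_iff₀ hlog2]
    linarith
  have hbound : ∀ c : ℕ,
      (∃ P : QuantumCommunication.Protocol n c, P.Computes (QuantumCommunication.HAM n k) (1 / 3)) →
      1 / 32 * ((n : ℝ) / L) ≤ c := by
    rintro c ⟨P, hP⟩
    have h := QuantumCommunication.le_mul_of_computes hk P hP
    have h' : (n : ℝ) ≤ 4 * (Nat.log 2 n + 3) * (c + 1) := by exact_mod_cast h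
    have hlog : (Nat.log 2 n : ℝ) ≤ L := by
      simpa using Real.natLog_le_logb n 2
    have h3 : (n : ℝ) ≤ 16 * L * (c + 1) :=
      h'.trans (mul_le_mul_of_nonneg_right (by linarith) (by positivity))
    rw [← mul_div_assoc, div_le_iff₀ (by linarith)]
    linarith
  -- The complexity is an infimum over natural numbers, so the real bound is rounded up before it
  -- enters `ℕ∞`.
  have hceil : ((⌈1 / 32 * ((n : ℝ) / L)⌉₊ : ℕ) : ℕ∞) ≤
      QuantumCommunication.BQC (QuantumCommunication.HAM n k) :=
    le_iInf₂ fun c hc => Nat.cast_le.mpr (Nat.ceil_le.mpr (hbound c hc))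
  calc ENNReal.ofReal (1 / 32 * ((n : ℝ) / L))
      ≤ ENNReal.ofReal (⌈1 / 32 * ((n : ℝ) / L)⌉₊ : ℕ) := ENNReal.ofReal_le_ofReal (Nat.le_ceil _)
    _ = (((⌈1 / 32 * ((n : ℝ) / L)⌉₊ : ℕ) : ℕ∞) : ℝ≥0∞) := by
        rw [ENNReal.ofReal_natCast, ENat.toENNReal_coe]
    _ ≤ _ := ENat.toENNReal_le.mpr hceil
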